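/- Let $G$ be a finite simple connected graph and let $x \neq y$ be vertices of $G$. Let $N(v,G)$ denote the set of neighbours of $v$ in $G$, put $X = N(x,G) \setminus (N(y,G) \cup \{y\})$, and let $G' = \diamondsuit_{xy}(G)$ be the graph obtained from $G$ by replacing each edge $xv$ with $v \in X$ by the edge $yv$. For a finite simple graph $F$ with $n$ vertices and $m$ edges, let $L(F) = D(F) - A(F)$ be its Laplacian matrix ($D(F)$ the diagonal degree matrix, $A(F)$ the adjacency matrix), let $\lambda(F)$ be the largest eigenvalue of $L(F)$, let $P(t,F)$ be the polynomial in $t$ with $\det(tI - L(F)) = t\,P(t,F)$, and let $\Phi(t,F) = t^{\,m-n+1} P(t,F)$. Write $G \succeq^{\phi} F$ if $\lambda(G) \le \lambda(F)$ and $\Phi(t,G) \ge \Phi(t,F)$ for every real $t \ge \lambda(F)$. Suppose that $G'$ is bipartite. Then (a1) $\lambda(G) \le \lambda(G')$, and moreover, (a2) $G \succeq^{\phi} G'$. -/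

import Mathlib

namespace KelmansGraph

/-- The set `X = N(x, G) \ (N(y, G) ∪ {y})` of neighbours moved by the diamond operation. -/
def movedSet {V : Type*} (G : SimpleGraph V) (x y : V) : Set V :=
  G.neighborSet x \ (G.neighborSet y ∪ {y})

/-- The star of edges `[v, X] = {vu : u ∈ X}`. -/
def starEdges {V : Type*} (v : V) (X : Set V) : Set (Sym2 V) :=
  (fun u => s(v, u)) '' X

/-- The diamond operation: `♢_{xy}(G) = (G - [x, X]) ∪ [y, X]`, where
`X = N(x, G) \ (N(y, G) ∪ {y})`. -/
def diamond {V : Type*} (G : SimpleGraph V) (x y : V) : SimpleGraph V :=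
  G.deleteEdges (starEdges x (movedSet G x y)) ⊔
    SimpleGraph.fromEdgeSet (starEdges y (movedSet G x y))

open Classical in
/-- The Laplacian matrix `L(G) = D(G) - A(G)`. -/
noncomputable def laplacian {V : Type*} [Fintype V] (G : SimpleGraph V) : Matrix V V ℝ :=
  G.lapMatrix ℝ

open Classical in
/-- The characteristic polynomial `L(t, G) = det (t I - L(G))`. -/
noncomputable def lapCharpoly {V : Type*} [Fintype V] (G : SimpleGraph V) : Polynomial ℝ :=
  (laplacian G).charpoly

/-- The Laplacian polynomial `P(t, G)`, that is, the quotient of `L(t, G)` by `t`. -/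
noncomputable def lapPoly {V : Type*} [Fintype V] (G : SimpleGraph V) : Polynomial ℝ :=
  (lapCharpoly G).divX

/-- `L(t, G) = t P(t, G)`. -/
theorem X_mul_lapPoly {V : Type*} [Fintype V] [Nonempty V] (G : SimpleGraph V) :
    Polynomial.X * lapPoly G = lapCharpoly G := by
  classical
  have h0 : (lapCharpoly G).coeff 0 = 0 := by
    have h := Matrix.det_eq_sign_charpoly_coeff (laplacian G)
    have hd : (laplacian G).det = 0 := by
      unfold laplacian
      exact G.det_lapMatrix_eq_zero
    rw [hd] at h
    have h2 := (mul_eq_zero.mp h.symm).resolve_left (by simp)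
    unfold lapCharpoly
    convert h2
  have h := Polynomial.X_mul_divX_add (lapCharpoly G)
  rw [h0] at h
  simpa [lapPoly] using h

open Classical in
/-- `λ(G)`, the largest eigenvalue of the Laplacian matrix. -/
noncomputable def topEigenvalue {V : Type*} [Fintype V] (G : SimpleGraph V) : ℝ :=
  sSup {μ : ℝ | Module.End.HasEigenvalue (Matrix.toLin' (laplacian G)) μ}

open Classical in
/-- The supremum that defines `λ(G)` is attained. -/
theorem isGreatest_topEigenvalue {V : Type*} [Fintype V] [Nonempty V] (G : SimpleGraph V) :
    IsGreatest {μ : ℝ | Module.End.HasEigenvalue (Matrix.toLin' (laplacian G)) μ}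
      (topEigenvalue G) := by
  have hfin : {μ : ℝ | Module.End.HasEigenvalue (Matrix.toLin' (laplacian G)) μ}.Finite :=
    Module.End.finite_hasEigenvalue _
  have hne : {μ : ℝ | Module.End.HasEigenvalue (Matrix.toLin' (laplacian G)) μ}.Nonempty := by
    refine ⟨0, ?_⟩
    obtain ⟨v, hv, hv0⟩ := Matrix.exists_mulVec_eq_zero_iff.mpr
      (show (laplacian G).det = 0 from G.det_lapMatrix_eq_zero)
    refine Module.End.hasEigenvalue_of_hasEigenvector (x := v) ⟨?_, hv⟩
    rw [Module.End.mem_eigenspace_iff]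
    simpa using hv0
  exact ⟨hne.csSup_mem hfin, fun μ hμ => le_csSup hfin.bddAbove hμ⟩

/-- `Φ(t, G) = t ^ (m - n + 1) * P(t, G)` for a graph with `n` vertices and `m` edges;
the exponent is an integer. -/
noncomputable def Phi {V : Type*} [Fintype V] (t : ℝ) (G : SimpleGraph V) : ℝ :=
  t ^ ((G.edgeSet.ncard : ℤ) - (Fintype.card V : ℤ) + 1) * (lapPoly G).eval t

/-- `G ⪰^φ F`: `λ(G) ≤ λ(F)` and `Φ(t, G) ≥ Φ(t, F)` for every real `t ≥ λ(F)`. -/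
def PhiGE {V W : Type*} [Fintype V] [Fintype W] (G : SimpleGraph V) (F : SimpleGraph W) : Prop :=
  topEigenvalue G ≤ topEigenvalue F ∧ ∀ t : ℝ, topEigenvalue F ≤ t → Phi t F ≤ Phi t G

end KelmansGraph

/-! For `t > λ(G')` the matrix `tI - L(G')` is positive definite. Away from `x` and `y` the
operation changes neither adjacency nor degree, so `tI - L(G)` and `tI - L(G')` share a block `B`
and differ only in the rows of `x` and `y`. With `a`, `b`, `c` the indicators of the neighbours of
`x` only, of `y` only and of both, these rows restrict to `a + c`, `b + c` in `G` and to `c`, `a + b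
+ c` in `G'`. Schur complements turn the comparison of determinants into one of 2×2 determinants
(`bordered_det_le_of_shift`). Bipartiteness makes `B⁻¹` nonnegative up to a sign vector that is
constant on the neighbours of `x` and `y`, so the cross terms have the needed sign. The resulting
inequality `det (tI - L(G')) ≤ det (tI - L(G))` yields both claims. -/

namespace Matrix

/-! ### Positive definite matrices with signed inverse, and 2×2 Schur complements. -/

variable {Z : Type*} [Fintype Z]

/-- A positive definite matrix whose off-diagonal entries have the signs `-σ i * σ j` for a sign
vector `σ` has an inverse with entries of sign `σ i * σ j`. -/
theorem PosDef.sign_mul_nonneg_of_mulVec {B : Matrix Z Z ℝ} (hB : B.PosDef) {σ : Z → ℝ}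
    (hσ : ∀ i, σ i * σ i = 1) (hoff : ∀ i j, i ≠ j → σ i * B i j * σ j ≤ 0) {w : Z → ℝ}
    (hw : ∀ i, 0 ≤ σ i * (B *ᵥ w) i) (i : Z) : 0 ≤ σ i * w i := by
  -- Test `B` against the part of `w` of wrong sign: `w + m` is the part of right sign, so `m ⬝ᵥ B
  -- (w + m) ≤ 0`, while `m ⬝ᵥ B w ≥ 0`. Hence `m ⬝ᵥ B m ≤ 0`, which forces `m = 0`.
  set m : Z → ℝ := fun i => σ i * (σ i * w i)⁻ with hm
  by_contra hi
  have hm0 : m ≠ 0 := by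
    intro h
    have h1 : σ i * (σ i * w i)⁻ = 0 := congrFun h i
    have h2 : σ i ≠ 0 := fun h => by simpa [h] using hσ i
    exact hi (negPart_eq_zero.mp ((mul_eq_zero.mp h1).resolve_left h2))
  have hpos := hB.dotProduct_mulVec_pos hm0
  have h1 : 0 ≤ m ⬝ᵥ (B *ᵥ w) := by
    refine Finset.sum_nonneg fun j _ => ?_
    have h := mul_nonneg (negPart_nonneg (σ j * w j)) (hw j)
    simp only [hm]
    linarith
  have h2 : m ⬝ᵥ (B *ᵥ (w + m)) ≤ 0 := by
    simp only [dotProduct, mulVec, Finset.mul_sum]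
    refine Finset.sum_nonpos fun j _ => Finset.sum_nonpos fun k _ => ?_
    have hk : (w + m) k = σ k * (σ k * w k)⁺ := by
      have h3 : (σ k * w k)⁺ = σ k * w k + (σ k * w k)⁻ := by
        have := posPart_sub_negPart (σ k * w k)
        linarith
      simp only [Pi.add_apply, hm, h3, mul_add, ← mul_assoc, hσ, one_mul]
    rw [hk]
    by_cases hjk : j = k
    · subst hjk
      have h4 : (σ j * w j)⁻ * (σ j * w j)⁺ = 0 := by
        rcases le_total 0 (σ j * w j) with h | h
        · rw [negPart_eq_zero.mpr h, zero_mul]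
        · rw [posPart_eq_zero.mpr h, mul_zero]
      refine le_of_eq ?_
      simp only [hm]
      linear_combination (σ j * B j j * σ j) * h4
    · have h5 := mul_nonpos_of_nonpos_of_nonneg (hoff j k hjk)
        (mul_nonneg (negPart_nonneg (σ j * w j)) (posPart_nonneg (σ k * w k)))
      simp only [hm]
      linarith
  rw [mulVec_add, dotProduct_add] at h2
  simp only [star_trivial] at hpos
  linarith

theorem PosDef.dotProduct_inv_mulVec_nonneg [DecidableEq Z] {B : Matrix Z Z ℝ} (hB : B.PosDef) {σ : Z → ℝ}
    (hσ : ∀ i, σ i * σ i = 1) (hoff : ∀ i j, i ≠ j → σ i * B i j * σ j ≤ 0) {u v : Z → ℝ}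
    (hu : ∀ i, 0 ≤ σ i * u i) (hv : ∀ i, 0 ≤ σ i * v i) : 0 ≤ u ⬝ᵥ (B⁻¹ *ᵥ v) := by
  have hdet : IsUnit B.det := hB.det_pos.ne'.isUnit
  have h : ∀ i, 0 ≤ σ i * (B⁻¹ *ᵥ v) i := hB.sign_mul_nonneg_of_mulVec hσ hoff (by
    rwa [mulVec_mulVec, mul_nonsing_inv _ hdet, one_mulVec])
  refine Finset.sum_nonneg fun i _ => ?_
  have h1 := mul_nonneg (hu i) (h i)
  linear_combination h1 + u i * (B⁻¹ *ᵥ v) i * hσ i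

/-- The symmetric matrix obtained from `B` by bordering it with the rows `v`, `w` and the corner
`!![p, q; q, r]`. -/
def bordered (B : Matrix Z Z ℝ) (v w : Z → ℝ) (p q r : ℝ) : Matrix (Z ⊕ Fin 2) (Z ⊕ Fin 2) ℝ :=
  fromBlocks B (of fun z i => ![v z, w z] i) (of fun z i => ![v z, w z] i)ᵀ !![p, q; q, r]

theorem schur_bordered (K : Matrix Z Z ℝ) (hK : Kᵀ = K) (v w : Z → ℝ) (p q r : ℝ) :
    !![p, q; q, r] - (of fun z i => ![v z, w z] i)ᵀ * K * (of fun z i => ![v z, w z] i) =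
      !![p - v ⬝ᵥ (K *ᵥ v), q - v ⬝ᵥ (K *ᵥ w); q - v ⬝ᵥ (K *ᵥ w), r - w ⬝ᵥ (K *ᵥ w)] := by
  have hs : w ⬝ᵥ (K *ᵥ v) = v ⬝ᵥ (K *ᵥ w) := by
    rw [dotProduct_mulVec, ← mulVec_transpose, hK, dotProduct_comm]
  have hmul : ∀ i j : Fin 2,
      ((of fun z i => ![v z, w z] i)ᵀ * K * (of fun z i => ![v z, w z] i)) i j =
        (fun z => ![v z, w z] i) ⬝ᵥ (K *ᵥ fun z => ![v z, w z] j) := by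
    intro i j
    rw [Matrix.mul_assoc]
    rfl
  ext i j
  rw [sub_apply, hmul]
  fin_cases i <;> fin_cases j <;> simp [hs]

theorem det_bordered [DecidableEq Z] {B : Matrix Z Z ℝ} (hB : B.PosDef) (v w : Z → ℝ) (p q r : ℝ) :
    (bordered B v w p q r).det = B.det *
      ((p - v ⬝ᵥ (B⁻¹ *ᵥ v)) * (r - w ⬝ᵥ (B⁻¹ *ᵥ w)) - (q - v ⬝ᵥ (B⁻¹ *ᵥ w)) ^ 2) := by
  let _ := invertibleOfIsUnitDet B hB.det_pos.ne'.isUnit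
  rw [bordered, det_fromBlocks₁₁, invOf_eq_nonsing_inv,
    schur_bordered _ (by simpa [IsHermitian] using hB.inv.isHermitian), det_fin_two_of]
  ring

theorem PosDef.schur_bordered_nonneg [DecidableEq Z] {B : Matrix Z Z ℝ} (hB : B.PosDef) {v w : Z → ℝ} {p q r : ℝ}
    (h : (bordered B v w p q r).PosDef) : 0 ≤ p - v ⬝ᵥ (B⁻¹ *ᵥ v) := by
  let _ := invertibleOfIsUnitDet B hB.det_pos.ne'.isUnit
  have h1 := h.posSemidef
  rw [bordered, ← conjTranspose_eq_transpose_of_trivial, PosDef.fromBlocks₁₁ _ _ hB,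
    conjTranspose_eq_transpose_of_trivial,
    schur_bordered _ (by simpa [IsHermitian] using hB.inv.isHermitian)] at h1
  simpa using h1.diag_nonneg (i := 0)

/-- Cauchy-Schwarz for a positive semidefinite matrix. -/
theorem PosSemidef.dotProduct_mulVec_sq_le {K : Matrix Z Z ℝ} (hK : K.PosSemidef) (u v : Z → ℝ) :
    (u ⬝ᵥ (K *ᵥ v)) ^ 2 ≤ u ⬝ᵥ (K *ᵥ u) * v ⬝ᵥ (K *ᵥ v) := by
  have hs : v ⬝ᵥ (K *ᵥ u) = u ⬝ᵥ (K *ᵥ v) := by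
    have hT : Kᵀ = K := by simpa [IsHermitian] using hK.isHermitian
    rw [dotProduct_mulVec, ← mulVec_transpose, hT, dotProduct_comm]
  have h : ∀ s : ℝ, 0 ≤ (v ⬝ᵥ (K *ᵥ v)) * (s * s) + (2 * u ⬝ᵥ (K *ᵥ v)) * s + u ⬝ᵥ (K *ᵥ u) := by
    intro s
    have h1 := hK.dotProduct_mulVec_nonneg (u + s • v)
    simp only [star_trivial, mulVec_add, add_dotProduct, dotProduct_add, mulVec_smul,
      smul_dotProduct, dotProduct_smul, smul_eq_mul, hs] at h1
    linarith
  have h2 := discrim_le_zero h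
  rw [discrim] at h2
  linarith

/-- Write `⟨u, v⟩ = u ⬝ᵥ B⁻¹ v`, `γ = ⟨a, b⟩`, `α = ∑ a + 2⟨c, a⟩ + ⟨a, a⟩`, `β = ∑ b + 2⟨c, b⟩ +
⟨b, b⟩`. After division by `det B` the two sides are `p (p - α - β - 2γ) - k²` and `(p - α)(p - β) -
(k - γ)²`. They differ by `(αβ - γ²) + 2γ(p + k)`: Cauchy-Schwarz handles the first term, positive
definiteness the second. -/
theorem bordered_det_le_of_shift [DecidableEq Z] {B : Matrix Z Z ℝ} {σ : Z → ℝ} (hσ : ∀ i, σ i * σ i = 1)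
    (hoff : ∀ i j, i ≠ j → σ i * B i j * σ j ≤ 0) {a b c : Z → ℝ} (ha : ∀ i, 0 ≤ a i)
    (hb : ∀ i, 0 ≤ b i) (hsa : ∀ i, 0 ≤ σ i * a i) (hsb : ∀ i, 0 ≤ σ i * b i)
    (hsc : ∀ i, 0 ≤ σ i * c i) (s q : ℝ)
    (h : (bordered B c (a + b + c) s q (s - ∑ i, a i - ∑ i, b i)).PosDef) :
    (bordered B c (a + b + c) s q (s - ∑ i, a i - ∑ i, b i)).det ≤
      (bordered B (a + c) (b + c) (s - ∑ i, a i) q (s - ∑ i, b i)).det := by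
  have hB : B.PosDef := by
    have := h.submatrix (e := (Sum.inl : Z → Z ⊕ Fin 2)) Sum.inl_injective
    exact this
  have hT : B⁻¹ᵀ = B⁻¹ := by simpa [IsHermitian] using hB.inv.isHermitian
  have hs : ∀ u v : Z → ℝ, u ⬝ᵥ (B⁻¹ *ᵥ v) = v ⬝ᵥ (B⁻¹ *ᵥ u) := fun u v => by
    rw [dotProduct_mulVec, ← mulVec_transpose, hT, dotProduct_comm]
  have hp := hB.schur_bordered_nonneg h
  have hd := h.det_pos
  have hBd := hB.det_pos
  rw [det_bordered hB] at hd
  rw [det_bordered hB, det_bordered hB]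
  refine mul_le_mul_of_nonneg_left ?_ hBd.le
  replace hd := pos_of_mul_pos_right hd hBd.le
  have hab := hB.dotProduct_inv_mulVec_nonneg hσ hoff hsa hsb
  have hca := hB.dotProduct_inv_mulVec_nonneg hσ hoff hsc hsa
  have hcb := hB.dotProduct_inv_mulVec_nonneg hσ hoff hsc hsb
  have haa : 0 ≤ a ⬝ᵥ (B⁻¹ *ᵥ a) := by
    simpa using hB.inv.posSemidef.dotProduct_mulVec_nonneg a
  have hbb : 0 ≤ b ⬝ᵥ (B⁻¹ *ᵥ b) := by
    simpa using hB.inv.posSemidef.dotProduct_mulVec_nonneg b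
  have hcs := hB.inv.posSemidef.dotProduct_mulVec_sq_le a b
  have hA : 0 ≤ ∑ i, a i := Finset.sum_nonneg fun i _ => ha i
  have hA' : 0 ≤ ∑ i, b i := Finset.sum_nonneg fun i _ => hb i
  simp only [mulVec_add, add_dotProduct, dotProduct_add, hs a c, hs b c, hs b a] at hd ⊢
  generalize a ⬝ᵥ (B⁻¹ *ᵥ b) = γ at *
  generalize c ⬝ᵥ (B⁻¹ *ᵥ a) = ca at *
  generalize c ⬝ᵥ (B⁻¹ *ᵥ b) = cb at *
  generalize c ⬝ᵥ (B⁻¹ *ᵥ c) = cc at *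
  generalize a ⬝ᵥ (B⁻¹ *ᵥ a) = aa at *
  generalize b ⬝ᵥ (B⁻¹ *ᵥ b) = bb at *
  generalize ∑ i, a i = A at *
  generalize ∑ i, b i = A' at *
  -- `p` and `k` are the first diagonal and the off-diagonal entry of the Schur complement of the
  -- positive definite matrix.
  obtain ⟨p, rfl⟩ : ∃ p, s = p + cc := ⟨s - cc, by ring⟩
  obtain ⟨k, rfl⟩ : ∃ k, q = k + (ca + cb + cc) := ⟨q - (ca + cb + cc), by ring⟩
  rw [add_sub_cancel_right] at hp
  have hαβ : γ ^ 2 ≤ (A + 2 * ca + aa) * (A' + 2 * cb + bb) :=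
    hcs.trans (mul_le_mul (by linarith) (by linarith) hbb (by linarith))
  -- The positive Schur determinant gives `k² < p (p - α - β - 2γ) ≤ p²`.
  have hkp : -p ≤ k := by
    have : |k| ≤ |p| := by
      rw [← sq_le_sq]
      have h3 := mul_nonneg hp (show 0 ≤ A + A' + 2 * ca + aa + 2 * cb + bb + 2 * γ by linarith)
      linear_combination hd + h3
    rw [abs_of_nonneg hp] at this
    exact neg_le_of_abs_le this
  have h4 := mul_nonneg hab (show 0 ≤ p + k by linarith)
  linear_combination hαβ + 2 * h4

end Matrix
namespace KelmansGraph

/-! ### Adjacency after the diamond operation. -/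

section Adjacency

variable {V : Type*} {G : SimpleGraph V} {x y : V}

theorem diamond_adj {u v : V} : (diamond G x y).Adj u v ↔
    (G.Adj u v ∧ s(u, v) ∉ starEdges x (movedSet G x y)) ∨
      (s(u, v) ∈ starEdges y (movedSet G x y) ∧ u ≠ v) := by
  simp [diamond, SimpleGraph.deleteEdges_adj]

theorem mk_mem_starEdges {X : Set V} {u v w : V} :
    s(u, v) ∈ starEdges w X ↔ (u = w ∧ v ∈ X) ∨ (v = w ∧ u ∈ X) := by
  simp only [starEdges, Set.mem_image, Sym2.eq_iff]
  grind

theorem mem_movedSet {v : V} : v ∈ movedSet G x y ↔ G.Adj x v ∧ ¬G.Adj y v ∧ v ≠ y := by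
  simp [movedSet]
  tauto

theorem diamond_adj_of_ne {u v : V} (hux : u ≠ x) (huy : u ≠ y) (hvx : v ≠ x) (hvy : v ≠ y) :
    (diamond G x y).Adj u v ↔ G.Adj u v := by
  simp [diamond_adj, mk_mem_starEdges, *]

theorem diamond_adj_left {v : V} (hxy : x ≠ y) (hvx : v ≠ x) (hvy : v ≠ y) :
    (diamond G x y).Adj x v ↔ G.Adj x v ∧ G.Adj y v := by
  simp [diamond_adj, mk_mem_starEdges, mem_movedSet, *]
  tauto

theorem diamond_adj_right {v : V} (hxy : x ≠ y) (hvx : v ≠ x) (hvy : v ≠ y) :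
    (diamond G x y).Adj y v ↔ G.Adj x v ∨ G.Adj y v := by
  simp [diamond_adj, mk_mem_starEdges, mem_movedSet, *, hxy.symm, hvy.symm]
  tauto

theorem diamond_adj_pair (hxy : x ≠ y) : (diamond G x y).Adj x y ↔ G.Adj x y := by
  simp [diamond_adj, mk_mem_starEdges, mem_movedSet, hxy, hxy.symm]

end Adjacency

/-! ### Separating `x` and `y` from the other vertices. -/

section Pair

variable {V : Type*} {x y : V}

/-- The vertices other than `x` and `y`. -/
abbrev Others (x y : V) : Type _ := {z : V // z ≠ x ∧ z ≠ y}

/-- The splitting of the vertex set into the vertices `x`, `y` and the others. -/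
noncomputable def splitPair (hxy : x ≠ y) : Others x y ⊕ Fin 2 ≃ V :=
  Equiv.ofBijective (Sum.elim Subtype.val ![x, y]) (by
    constructor
    · rintro (⟨a, ha⟩ | i) (⟨b, hb⟩ | j) h
      · simpa using h
      · fin_cases j
        · exact absurd h ha.1
        · exact absurd h ha.2
      · fin_cases i
        · exact absurd h.symm hb.1
        · exact absurd h.symm hb.2
      · fin_cases i <;> fin_cases j <;> simp_all [eq_comm]
    · intro v
      by_cases hx : v = x
      · exact ⟨.inr 0, by simp [hx]⟩
      by_cases hy : v = y
      · exact ⟨.inr 1, by simp [hy]⟩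
      exact ⟨.inl ⟨v, hx, hy⟩, rfl⟩)

@[simp] theorem splitPair_inl (hxy : x ≠ y) (z : Others x y) : splitPair hxy (.inl z) = z := rfl

@[simp] theorem splitPair_zero (hxy : x ≠ y) : splitPair hxy (.inr 0) = x := rfl

@[simp] theorem splitPair_one (hxy : x ≠ y) : splitPair hxy (.inr 1) = y := rfl

open Classical in
theorem sum_splitPair [Fintype V] (hxy : x ≠ y) (f : V → ℝ) :
    ∑ v, f v = ∑ z : Others x y, f z + (f x + f y) := by
  rw [← (splitPair hxy).sum_comp, Fintype.sum_sum_type, Fin.sum_univ_two]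
  rfl

end Pair

/-! ### The matrix `tI - L(G)` and its bordered form. -/

section Laplacian

variable {V : Type*} [Fintype V] (G : SimpleGraph V)

open Classical in
/-- The adjacency indicator. -/
noncomputable def adjInd {V : Type*} (G : SimpleGraph V) (u v : V) : ℝ := if G.Adj u v then 1 else 0

theorem adjInd_congr {V : Type*} {G H : SimpleGraph V} {u v u' v' : V}
    (h : G.Adj u v ↔ H.Adj u' v') : adjInd G u v = adjInd H u' v' := by
  by_cases h' : G.Adj u v
  · simp [adjInd, h', h.mp h']
  · simp [adjInd, h', mt h.mpr h']

theorem adjInd_comm {V : Type*} (G : SimpleGraph V) (u v : V) : adjInd G u v = adjInd G v u :=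
  adjInd_congr (G.adj_comm u v)

theorem adjInd_nonneg {V : Type*} (G : SimpleGraph V) (u v : V) : 0 ≤ adjInd G u v := by
  by_cases h : G.Adj u v <;> simp [adjInd, h]

theorem adjInd_le_one {V : Type*} (G : SimpleGraph V) (u v : V) : adjInd G u v ≤ 1 := by
  by_cases h : G.Adj u v <;> simp [adjInd, h]

@[simp] theorem adjInd_self {V : Type*} (G : SimpleGraph V) (u : V) : adjInd G u u = 0 := by
  simp [adjInd]

open Classical in
/-- The matrix `t I - L(G)`. -/
noncomputable def charLap (t : ℝ) : Matrix V V ℝ := Matrix.scalar V t - laplacian G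

theorem charLap_apply_self (t : ℝ) (u : V) : charLap G t u u = t - ∑ v, adjInd G u v := by
  classical
  simp only [charLap, laplacian, SimpleGraph.lapMatrix, SimpleGraph.degMatrix, Matrix.sub_apply,
    Matrix.scalar_apply, Matrix.diagonal_apply_eq, SimpleGraph.adjMatrix_apply, adjInd,
    SimpleGraph.degree_eq_sum_if_adj]
  simp

theorem charLap_apply_ne (t : ℝ) {u v : V} (h : u ≠ v) : charLap G t u v = adjInd G u v := by
  classical
  simp only [charLap, laplacian, SimpleGraph.lapMatrix, SimpleGraph.degMatrix, Matrix.sub_apply,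
    Matrix.scalar_apply, Matrix.diagonal_apply_ne _ h, SimpleGraph.adjMatrix_apply, adjInd]
  simp

open Classical in
theorem eval_lapCharpoly (t : ℝ) : (lapCharpoly G).eval t = (charLap G t).det := by
  rw [lapCharpoly, Matrix.eval_charpoly, charLap]

theorem isHermitian_charLap (t : ℝ) : (charLap G t).IsHermitian := by
  classical
  refine Matrix.IsHermitian.sub ?_ (G.isHermitian_lapMatrix ℝ)
  rw [Matrix.scalar_apply]
  exact Matrix.isHermitian_diagonal _

theorem posDef_charLap [Nonempty V] {t : ℝ} (ht : topEigenvalue G < t) : (charLap G t).PosDef := by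
  classical
  rw [(isHermitian_charLap G t).posDef_iff_eigenvalues_pos]
  intro i
  set hA := isHermitian_charLap G t
  have h1 := hA.mulVec_eigenvectorBasis i
  set v : V → ℝ := (hA.eigenvectorBasis i).ofLp
  have hv : v ≠ 0 := (WithLp.ofLp_eq_zero 2).ne.2 <| hA.eigenvectorBasis.orthonormal.ne_zero i
  have h2 : Module.End.HasEigenvalue (Matrix.toLin' (laplacian G)) (t - hA.eigenvalues i) := by
    refine Module.End.hasEigenvalue_of_hasEigenvector (x := v) ⟨?_, hv⟩
    rw [Module.End.mem_eigenspace_iff, Matrix.toLin'_apply, sub_smul, ← h1, charLap,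
      Matrix.sub_mulVec]
    simp [Matrix.scalar_apply, Matrix.diagonal_const_mulVec]
  have h3 := (isGreatest_topEigenvalue G).2 h2
  linarith

theorem eval_lapCharpoly_topEigenvalue [Nonempty V] :
    (lapCharpoly G).eval (topEigenvalue G) = 0 := by
  classical
  have h := (isGreatest_topEigenvalue G).1
  rw [lapCharpoly]
  have h2 := (Module.End.hasEigenvalue_iff_isRoot_charpoly _ _).mp h
  rwa [Matrix.charpoly_toLin', Polynomial.IsRoot.def] at h2

theorem topEigenvalue_nonneg [Nonempty V] : 0 ≤ topEigenvalue G := by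
  classical
  refine (isGreatest_topEigenvalue G).2 ?_
  show Module.End.HasEigenvalue _ _
  rw [Module.End.hasEigenvalue_iff_isRoot_charpoly, Matrix.charpoly_toLin', Polynomial.IsRoot.def]
  have h : (lapCharpoly G).eval 0 = 0 := by
    rw [← X_mul_lapPoly]
    simp
  exact h

theorem sum_adjInd_eq_two_mul_ncard_edgeSet : ∑ u, ∑ v, adjInd G u v = 2 * (G.edgeSet.ncard : ℝ) := by
  classical
  have h := G.sum_degrees_eq_twice_card_edges
  rw [← SimpleGraph.coe_edgeFinset, Set.ncard_coe_finset]
  simp only [adjInd, ← SimpleGraph.degree_eq_sum_if_adj]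
  exact_mod_cast h

open Classical in
theorem charLap_submatrix {x y : V} (hxy : x ≠ y) (t : ℝ) :
    (charLap G t).submatrix (splitPair hxy) (splitPair hxy) =
      Matrix.bordered ((charLap G t).submatrix (Subtype.val : Others x y → V) Subtype.val)
        (fun z => adjInd G x z) (fun z => adjInd G y z)
        (t - adjInd G x y - ∑ z : Others x y, adjInd G x z) (adjInd G x y)
        (t - adjInd G x y - ∑ z : Others x y, adjInd G y z) := by
  ext (z | i) (w | j)
  · rfl
  · fin_cases j
    · simpa [Matrix.bordered, adjInd_comm G x] using charLap_apply_ne G t z.2.1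
    · simpa [Matrix.bordered, adjInd_comm G y] using charLap_apply_ne G t z.2.2
  · fin_cases i
    · simpa [Matrix.bordered] using charLap_apply_ne G t w.2.1.symm
    · simpa [Matrix.bordered] using charLap_apply_ne G t w.2.2.symm
  · fin_cases i <;> fin_cases j
    · simp [Matrix.bordered, charLap_apply_self, sum_splitPair hxy]
      ring
    · simp [Matrix.bordered, charLap_apply_ne _ _ hxy]
    · simp [Matrix.bordered, charLap_apply_ne _ _ hxy.symm, adjInd_comm G y x]
    · simp [Matrix.bordered, charLap_apply_self, sum_splitPair hxy, adjInd_comm G y x]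
      ring

end Laplacian

/-! ### Comparison of `G` with its diamond. -/

section Diamond

variable {V : Type*} {G : SimpleGraph V} {x y : V}

theorem adjInd_diamond_pair (hxy : x ≠ y) : adjInd (diamond G x y) x y = adjInd G x y :=
  adjInd_congr (diamond_adj_pair hxy)

theorem adjInd_diamond_others (z w : Others x y) :
    adjInd (diamond G x y) z w = adjInd G z w :=
  adjInd_congr (diamond_adj_of_ne z.2.1 z.2.2 w.2.1 w.2.2)

theorem adjInd_diamond_left (hxy : x ≠ y) (z : Others x y) :
    adjInd (diamond G x y) x z = adjInd G x z * adjInd G y z := by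
  have h := diamond_adj_left (G := G) hxy z.2.1 z.2.2
  by_cases hx : G.Adj x z <;> by_cases hy : G.Adj y z <;> simp [adjInd, h, hx, hy]

theorem adjInd_diamond_right (hxy : x ≠ y) (z : Others x y) :
    adjInd (diamond G x y) y z = adjInd G x z * (1 - adjInd G y z) +
      adjInd G y z * (1 - adjInd G x z) + adjInd G x z * adjInd G y z := by
  have h := diamond_adj_right (G := G) hxy z.2.1 z.2.2
  by_cases hx : G.Adj x z <;> by_cases hy : G.Adj y z <;> simp [adjInd, h, hx, hy]

theorem adjInd_diamond_add (hxy : x ≠ y) (z : Others x y) :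
    adjInd (diamond G x y) x z + adjInd (diamond G x y) y z = adjInd G x z + adjInd G y z := by
  rw [adjInd_diamond_left hxy, adjInd_diamond_right hxy]
  ring

variable [Fintype V]

theorem sum_adjInd_diamond_others (hxy : x ≠ y) (z : Others x y) :
    ∑ v, adjInd (diamond G x y) z v = ∑ v, adjInd G z v := by
  classical
  rw [sum_splitPair hxy, sum_splitPair hxy, adjInd_comm _ z.1 x, adjInd_comm _ z.1 y,
    adjInd_comm _ z.1 x, adjInd_comm _ z.1 y, adjInd_diamond_add hxy]
  simp only [adjInd_diamond_others]

theorem charLap_diamond_submatrix (hxy : x ≠ y) (t : ℝ) :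
    (charLap (diamond G x y) t).submatrix (Subtype.val : Others x y → V)
        (Subtype.val : Others x y → V) = (charLap G t).submatrix Subtype.val Subtype.val := by
  ext z w
  by_cases h : z = w
  · subst h
    simp only [Matrix.submatrix_apply, charLap_apply_self, sum_adjInd_diamond_others hxy]
  · simp only [Matrix.submatrix_apply, charLap_apply_ne _ _ (Subtype.coe_ne_coe.mpr h),
      adjInd_diamond_others]

/-- Ensures that `Phi` carries the same power of `t` for both graphs. -/
theorem ncard_edgeSet_diamond (hxy : x ≠ y) :
    (diamond G x y).edgeSet.ncard = G.edgeSet.ncard := by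
  classical
  have h : 2 * ((diamond G x y).edgeSet.ncard : ℝ) = 2 * (G.edgeSet.ncard : ℝ) := by
    rw [← sum_adjInd_eq_two_mul_ncard_edgeSet, ← sum_adjInd_eq_two_mul_ncard_edgeSet, sum_splitPair hxy fun u => ∑ v, adjInd _ u v,
      sum_splitPair hxy fun u => ∑ v, adjInd _ u v]
    simp only [sum_adjInd_diamond_others hxy]
    rw [← Finset.sum_add_distrib, ← Finset.sum_add_distrib, sum_splitPair hxy, sum_splitPair hxy]
    simp only [adjInd_diamond_add hxy, adjInd_self, adjInd_comm _ y x, adjInd_diamond_pair hxy]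
  have h' := mul_left_cancel₀ two_ne_zero h
  exact_mod_cast h'

open Classical in
theorem det_charLap_diamond_le (hxy : x ≠ y) (hbip : (diamond G x y).IsBipartite) {t : ℝ}
    (ht : topEigenvalue (diamond G x y) < t) :
    (charLap (diamond G x y) t).det ≤ (charLap G t).det := by
  have : Nonempty V := ⟨x⟩
  obtain ⟨C⟩ := hbip
  -- Every neighbour of `x` or `y` in `G`, other than these two, is adjacent to `y` in `G'`, so it
  -- avoids the colour of `y` and gets sign `1`.
  set σ : Others x y → ℝ := fun z => if C z = C y then -1 else 1 with hσ
  set a : Others x y → ℝ := fun z => adjInd G x z * (1 - adjInd G y z) with ha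
  set b : Others x y → ℝ := fun z => adjInd G y z * (1 - adjInd G x z) with hb
  set c : Others x y → ℝ := fun z => adjInd G x z * adjInd G y z with hc
  have hsign : ∀ z : Others x y, G.Adj x z ∨ G.Adj y z → σ z = 1 := fun z hz => by
    have := C.valid ((diamond_adj_right hxy z.2.1 z.2.2).mpr hz)
    simp [hσ, this.symm]
  have ha0 : ∀ z, 0 ≤ a z := fun z =>
    mul_nonneg (adjInd_nonneg G x z) (sub_nonneg.mpr (adjInd_le_one G y z))
  have hb0 : ∀ z, 0 ≤ b z := fun z =>
    mul_nonneg (adjInd_nonneg G y z) (sub_nonneg.mpr (adjInd_le_one G x z))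
  have hc0 : ∀ z, 0 ≤ c z := fun z => mul_nonneg (adjInd_nonneg G x z) (adjInd_nonneg G y z)
  have hpd := (posDef_charLap _ ht).submatrix (splitPair hxy).injective
  have hG : (charLap G t).det = (Matrix.bordered
      ((charLap G t).submatrix (Subtype.val : Others x y → V) Subtype.val) (a + c) (b + c)
        ((t - adjInd G x y - ∑ z, c z) - ∑ z, a z) (adjInd G x y)
        ((t - adjInd G x y - ∑ z, c z) - ∑ z, b z)).det := by
    rw [← Matrix.det_submatrix_equiv_self (splitPair hxy), charLap_submatrix]
    have h1 : a + c = fun z : Others x y => adjInd G x z := by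
      ext z; simp only [ha, hc, Pi.add_apply]; ring
    have h2 : b + c = fun z : Others x y => adjInd G y z := by
      ext z; simp only [hb, hc, Pi.add_apply]; ring
    have h3 : ∑ z, c z + ∑ z, a z = ∑ z : Others x y, adjInd G x z := by
      rw [add_comm, ← Finset.sum_add_distrib, ← h1]; rfl
    have h4 : ∑ z, c z + ∑ z, b z = ∑ z : Others x y, adjInd G y z := by
      rw [add_comm, ← Finset.sum_add_distrib, ← h2]; rfl
    rw [sub_sub _ (∑ z, c z), sub_sub _ (∑ z, c z), h1, h2, h3, h4]
  have hG' : (charLap (diamond G x y) t).submatrix (splitPair hxy) (splitPair hxy) =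
      Matrix.bordered ((charLap G t).submatrix (Subtype.val : Others x y → V) Subtype.val)
        c (a + b + c) (t - adjInd G x y - ∑ z, c z) (adjInd G x y)
        ((t - adjInd G x y - ∑ z, c z) - ∑ z, a z - ∑ z, b z) := by
    rw [charLap_submatrix, charLap_diamond_submatrix hxy, adjInd_diamond_pair hxy]
    simp only [adjInd_diamond_left hxy, adjInd_diamond_right hxy, Finset.sum_add_distrib]
    congr 1
    simp only [ha, hb, hc]
    ring
  rw [← Matrix.det_submatrix_equiv_self (splitPair hxy), hG]
  rw [hG'] at hpd ⊢
  refine Matrix.bordered_det_le_of_shift (σ := σ) ?_ ?_ ?_ ?_ ?_ ?_ ?_ _ _ hpd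
  · intro z
    simp only [hσ]
    split_ifs <;> norm_num
  · intro z w hzw
    rw [Matrix.submatrix_apply, charLap_apply_ne _ _ (Subtype.coe_ne_coe.mpr hzw), adjInd]
    split_ifs with h
    · have h1 := C.valid ((diamond_adj_of_ne z.2.1 z.2.2 w.2.1 w.2.2).mpr h)
      simp only [hσ]
      split_ifs with hz hw hw
      · exact absurd (hz.trans hw.symm) h1
      · norm_num
      · norm_num
      -- With only two colours, two vertices avoiding the colour of `y` share a colour.
      · exact absurd (by omega) h1
    · simp
  · exact ha0
  · exact hb0
  all_goals
    intro z
    by_cases hz : G.Adj x z ∨ G.Adj y z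
    · rw [hsign z hz, one_mul]
      first | exact ha0 z | exact hb0 z | exact hc0 z
    · simp [ha, hb, hc, adjInd, not_or.mp hz]

theorem eval_lapPoly_diamond_le (hxy : x ≠ y) (hbip : (diamond G x y).IsBipartite) {t : ℝ}
    (ht : topEigenvalue (diamond G x y) ≤ t) :
    (lapPoly (diamond G x y)).eval t ≤ (lapPoly G).eval t := by
  have : Nonempty V := ⟨x⟩
  have key : ∀ s ∈ Set.Ioi t, (lapPoly (diamond G x y)).eval s ≤ (lapPoly G).eval s := by
    intro s hs
    have hs' := ht.trans_lt hs
    have h := det_charLap_diamond_le hxy hbip hs'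
    rw [← eval_lapCharpoly, ← eval_lapCharpoly, ← X_mul_lapPoly, ← X_mul_lapPoly] at h
    simp only [Polynomial.eval_mul, Polynomial.eval_X] at h
    exact le_of_mul_le_mul_left h ((topEigenvalue_nonneg _).trans_lt hs')
  -- Continuity from the right reaches `t = λ(G')`, where positive definiteness fails, and avoids
  -- dividing by `t = 0`.
  exact le_on_closure key (Polynomial.continuous _).continuousOn (Polynomial.continuous _).continuousOn
    (by rw [closure_Ioi]; exact Set.self_mem_Ici)

theorem topEigenvalue_le_diamond (hxy : x ≠ y) (hbip : (diamond G x y).IsBipartite) :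
    topEigenvalue G ≤ topEigenvalue (diamond G x y) := by
  have : Nonempty V := ⟨x⟩
  classical
  by_contra! h
  -- At `t = λ(G) > λ(G')` the determinant for `G` vanishes, yet it bounds the positive one for `G'`
  -- from above.
  have h1 := det_charLap_diamond_le hxy hbip h
  rw [← eval_lapCharpoly G, eval_lapCharpoly_topEigenvalue] at h1
  exact absurd (posDef_charLap _ h).det_pos (not_lt.mpr h1)

theorem phiGE_diamond (hxy : x ≠ y) (hbip : (diamond G x y).IsBipartite) :
    PhiGE G (diamond G x y) := by
  have : Nonempty V := ⟨x⟩
  refine ⟨topEigenvalue_le_diamond hxy hbip, fun t ht => ?_⟩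
  rw [Phi, Phi, ncard_edgeSet_diamond hxy]
  exact mul_le_mul_of_nonneg_left (eval_lapPoly_diamond_le hxy hbip ht)
    (zpow_nonneg ((topEigenvalue_nonneg _).trans ht) _)

end Diamond

end KelmansGraph

theorem mainTheorem11 {V : Type*} [Fintype V] (G : SimpleGraph V) (x y : V) (hxy : x ≠ y)
    (hG : G.Connected) (hbip : (KelmansGraph.diamond G x y).IsBipartite) :
    KelmansGraph.topEigenvalue G ≤ KelmansGraph.topEigenvalue (KelmansGraph.diamond G x y) ∧
      KelmansGraph.PhiGE G (KelmansGraph.diamond G x y) :=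
  ⟨KelmansGraph.topEigenvalue_le_diamond hxy hbip, KelmansGraph.phiGE_diamond hxy hbip⟩
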